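/- Corollary (continuous piecewise-linear functions). Let $n, m \in \mathbb{N}$, let $K \subset \mathbb{R}^n$ be compact, and let $f : K \to \mathbb{R}^m$ be continuous and piecewise linear, i.e. $K$ is covered by finitely many polyhedra $P_1,\dots,P_p \subset \mathbb{R}^n$ (each a finite intersection of open or closed half-spaces) and for each $j$ there are a matrix $\alpha_j$ and a vector $\beta_j$ such that $f(x) = \alpha_j x + \beta_j$ for all $x \in K \cap P_j$. Then there is a ReLU network $\mathcal{S} : \mathbb{R}^n \to \mathbb{R}^m$ with exactly three hidden layers, weights in $\bar{\mathbb{R}} = \mathbb{R} \cup \{\infty\}$ and real biases, such that $\mathcal{S}(x) = f(x)$ for all $x \in K$. Here a ReLU network with $L$ hidden layers is a map $\mathcal{S}(x) = W^{(L+1)}\chi^{(L)} + b^{(L+1)}$, where $\chi^{(0)} = x$, $\chi^{(l)} = \sigma(W^{(l)}\chi^{(l-1)} + b^{(l)})$ for $1 \le l \le L$, and $\sigma$ is $t \mapsto \max\{0,t\}$ applied entrywise. The layers are evaluated in $[-\infty,\infty]$ with the conventions $0\cdot\infty = 0$, $a \cdot \infty = \infty$ for $a>0$, $a\cdot\infty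 = -\infty$ for $a<0$, and $\sigma(-\infty)=0$; that $\mathcal{S}$ is a map $\mathbb{R}^n \to \mathbb{R}^m$ means that for every $x \in \mathbb{R}^n$ no expression $\infty - \infty$ occurs in the evaluation and the output is a vector of real numbers. -/

import Mathlib

open Matrix

/-- The weights `ℝ ∪ {∞}`: extended reals other than `-∞`. -/
abbrev ExtWeight : Type := {w : EReal // w ≠ ⊥}

/-- `ExtReLUNetwork m L n` is the type of feed-forward ReLU networks with `n` inputs, `L` hidden
layers (of arbitrary finite widths) and `m` outputs, whose weight matrices have entries in
`ℝ ∪ {∞}` and whose biases are real. The layers are listed from the input to the output. -/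
inductive ExtReLUNetwork (m : ℕ) : ℕ → ℕ → Type where
  | output {n : ℕ} (W : Matrix (Fin m) (Fin n) ExtWeight) (b : Fin m → ℝ) :
      ExtReLUNetwork m 0 n
  | hidden {n k L : ℕ} (W : Matrix (Fin k) (Fin n) ExtWeight) (b : Fin k → ℝ)
      (next : ExtReLUNetwork m L k) : ExtReLUNetwork m (L + 1) n

namespace ExtReLUNetwork

/-- The affine part `W χ + b` of a layer, computed in `[-∞, ∞]` with `0 * ∞ = 0`,
`a * ∞ = ∞` for `a > 0` and `a * ∞ = -∞` for `a < 0`.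
The value is meaningful only if `LayerDefined W χ` holds. -/
noncomputable def layer {k n : ℕ} (W : Matrix (Fin k) (Fin n) ExtWeight) (b : Fin k → ℝ)
    (χ : Fin n → EReal) : Fin k → EReal :=
  fun i => ∑ j, (W i j : EReal) * χ j + (b i : EReal)

/-- No sum in `W χ` is of the indeterminate form `∞ - ∞`. -/
def LayerDefined {k n : ℕ} (W : Matrix (Fin k) (Fin n) ExtWeight) (χ : Fin n → EReal) : Prop :=
  ∀ i, ¬ ((∃ j, (W i j : EReal) * χ j = ⊤) ∧ (∃ j, (W i j : EReal) * χ j = ⊥))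

/-- The element-wise ReLU activation. -/
noncomputable def relu {k : ℕ} (y : Fin k → EReal) : Fin k → EReal :=
  fun i => max 0 (y i)

/-- The output of the network on an input (or on the activations of a preceding layer). -/
noncomputable def eval {m : ℕ} : {L n : ℕ} → ExtReLUNetwork m L n → (Fin n → EReal) → Fin m → EReal
  | _, _, output W b, χ => layer W b χ
  | _, _, hidden W b next, χ => next.eval (relu (layer W b χ))

/-- On the given input no indeterminate form `∞ - ∞` occurs in any layer. -/
def DefinedAt {m : ℕ} : {L n : ℕ} → ExtReLUNetwork m L n → (Fin n → EReal) → Prop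
  | _, _, output W _, χ => LayerDefined W χ
  | _, _, hidden W b next, χ => LayerDefined W χ ∧ next.DefinedAt (relu (layer W b χ))

/-- The network is a well-defined function `ℝⁿ → ℝᵐ`, namely `g`: on every real input no
indeterminate form occurs, and the output is the real vector `g x`. -/
def Computes {m L n : ℕ} (S : ExtReLUNetwork m L n) (g : (Fin n → ℝ) → (Fin m → ℝ)) : Prop :=
  ∀ x : Fin n → ℝ, S.DefinedAt (fun j => (x j : EReal)) ∧
    S.eval (fun j => (x j : EReal)) = fun i => (g x i : EReal)

end ExtReLUNetwork

/-- A finite intersection of half-spaces, each closed (`a ⬝ x ≤ c`) or open (`a ⬝ x < c`). -/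
def IsPolyhedron {n : ℕ} (P : Set (Fin n → ℝ)) : Prop :=
  ∃ s t : Finset ((Fin n → ℝ) × ℝ),
    P = {x | (∀ h ∈ s, h.1 ⬝ᵥ x ≤ h.2) ∧ (∀ h ∈ t, h.1 ⬝ᵥ x < h.2)}

/-- `f` is piecewise linear on `K`: finitely many polyhedra cover `K`, and on the part of `K`
in each of them `f` is given by an affine map `x ↦ α x + β`. -/
def IsPiecewiseLinearOn {n m : ℕ} (f : (Fin n → ℝ) → (Fin m → ℝ)) (K : Set (Fin n → ℝ)) : Prop :=
  ∃ (p : ℕ) (P : Fin p → Set (Fin n → ℝ)) (α : Fin p → Matrix (Fin m) (Fin n) ℝ)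
    (β : Fin p → Fin m → ℝ),
    (∀ j, IsPolyhedron (P j)) ∧ K ⊆ ⋃ j, P j ∧
      ∀ j, ∀ x ∈ K ∩ P j, f x = α j *ᵥ x + β j

/-! An infinite weight turns a constraint violation `max 0 (a ⬝ᵥ x - c)` into a gate, `0` if the
constraint holds and `∞` otherwise. Subtracting the gate before a ReLU multiplies a nonnegative
value by the indicator of a closed polyhedron. So three hidden layers compute every linear
combination of rectified affine functions cut off to closed polyhedra (`gated_computes`). The span
of these functions contains the affine functions and is stable under restriction to half-spaces,
complements and intersections, hence to all polyhedra. Affine pieces can therefore be glued inside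
it (`exists_glue_mem_gatedSpan`). -/

namespace ExtReLUNetwork

/-- A real number as a weight. -/
def realWeight (r : ℝ) : ExtWeight := ⟨(r : EReal), EReal.coe_ne_bot r⟩

/-- The weight `∞`. -/
noncomputable def topWeight : ExtWeight := ⟨⊤, top_ne_bot⟩

@[simp] lemma coe_realWeight (r : ℝ) : (realWeight r : EReal) = (r : EReal) := rfl

@[simp] lemma coe_topWeight : (topWeight : EReal) = ⊤ := rfl

lemma coe_sum_ereal {ι : Type*} (s : Finset ι) (u : ι → ℝ) :
    ((∑ i ∈ s, u i : ℝ) : EReal) = ∑ i ∈ s, (u i : EReal) := by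
  classical
  induction s using Finset.induction_on with
  | empty => simp
  | insert a s ha ih => rw [Finset.sum_insert ha, Finset.sum_insert ha, EReal.coe_add, ih]

lemma coe_max_zero (r : ℝ) : max 0 (r : EReal) = ((max 0 r : ℝ) : EReal) := by
  rw [EReal.coe_strictMono.monotone.map_max, EReal.coe_zero]

/-- A layer with real weights and real inputs is always defined. -/
lemma layerDefined_real {k n : ℕ} (W : Matrix (Fin k) (Fin n) ℝ) (u : Fin n → ℝ) :
    LayerDefined (fun i j => realWeight (W i j)) (fun j => (u j : EReal)) := by
  rintro i ⟨⟨j, hj⟩, -⟩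
  rw [coe_realWeight, ← EReal.coe_mul] at hj
  exact EReal.coe_ne_top _ hj

lemma layer_real {k n : ℕ} (W : Matrix (Fin k) (Fin n) ℝ) (b : Fin k → ℝ) (u : Fin n → ℝ) :
    layer (fun i j => realWeight (W i j)) b (fun j => (u j : EReal)) =
      fun i => ((∑ j, W i j * u j + b i : ℝ) : EReal) := by
  funext i
  simp only [layer, coe_realWeight, EReal.coe_add, coe_sum_ereal, EReal.coe_mul]

lemma relu_real {k : ℕ} (u : Fin k → ℝ) :
    relu (fun i => (u i : EReal)) = fun i => ((max 0 (u i) : ℝ) : EReal) := by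
  funext i
  exact coe_max_zero _

/-! ### Gating by infinite weights -/

section Gated

variable {n m N q : ℕ}

/-- First layer: the `N` values to be gated, then the `q` violations of the constraints. -/
def inputWeights (L : Fin N → (Fin n → ℝ) × ℝ) (H : Fin q → (Fin n → ℝ) × ℝ) :
    Matrix (Fin (N + q)) (Fin n) ℝ :=
  fun i => Fin.append (fun k => (L k).1) (fun l => (H l).1) i

/-- Biases of the first layer. -/
def inputBias (L : Fin N → (Fin n → ℝ) × ℝ) (H : Fin q → (Fin n → ℝ) × ℝ) : Fin (N + q) → ℝ :=
  Fin.append (fun k => -(L k).2) (fun l => -(H l).2)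

open Classical in
/-- Second layer: copies of the `N` values, and `N` gates, each of which adds up its constraint
violations with weight `∞`. -/
noncomputable def gateWeights (G : Fin N → Fin q → Prop) :
    Matrix (Fin (N + N)) (Fin (N + q)) ExtWeight :=
  fun i => Fin.append
    (fun k => Fin.append (fun k' => realWeight (if k = k' then 1 else 0)) (fun _ => realWeight 0))
    (fun k => Fin.append (fun _ => realWeight 0)
      (fun l => if G k l then topWeight else realWeight 0)) i

/-- Third layer: each value minus its gate. -/
def subWeights (N : ℕ) : Matrix (Fin N) (Fin (N + N)) ExtWeight :=
  fun k => Fin.append (fun k' => realWeight (if k = k' then 1 else 0))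
    (fun k' => realWeight (if k = k' then -1 else 0))

/-- The network with three hidden layers that computes linear combinations of rectified affine
functions restricted to closed polyhedra. -/
noncomputable def gated (L : Fin N → (Fin n → ℝ) × ℝ) (H : Fin q → (Fin n → ℝ) × ℝ)
    (G : Fin N → Fin q → Prop) (w : Matrix (Fin m) (Fin N) ℝ) : ExtReLUNetwork m 3 n :=
  hidden (fun i j => realWeight (inputWeights L H i j)) (inputBias L H) <|
    hidden (gateWeights G) 0 <|
      hidden (subWeights N) 0 <|
        output (fun i j => realWeight (w i j)) 0

lemma relu_layer_input (L : Fin N → (Fin n → ℝ) × ℝ) (H : Fin q → (Fin n → ℝ) × ℝ)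
    (x : Fin n → ℝ) :
    relu (layer (fun i j => realWeight (inputWeights L H i j)) (inputBias L H)
        (fun j => (x j : EReal))) =
      fun i => ((Fin.append (fun k => max 0 ((L k).1 ⬝ᵥ x - (L k).2))
        (fun l => max 0 ((H l).1 ⬝ᵥ x - (H l).2)) i : ℝ) : EReal) := by
  rw [layer_real, relu_real]
  funext i
  refine Fin.addCases (fun k => ?_) (fun l => ?_) i <;>
    simp [inputWeights, inputBias, dotProduct, sub_eq_add_neg]

lemma top_mul_coe_nonneg {r : ℝ} (hr : 0 ≤ r) :
    (⊤ : EReal) * (r : EReal) = if r = 0 then 0 else ⊤ := by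
  split_ifs with h
  · simp [h]
  · exact EReal.top_mul_coe_of_pos (lt_of_le_of_ne hr (Ne.symm h))

/-- Infinite weights meet only nonnegative activations, so the gate sums never contain `-∞`. -/
lemma gateWeights_mul_ne_bot (G : Fin N → Fin q → Prop) {u : Fin N → ℝ} {v : Fin q → ℝ}
    (hv : ∀ l, 0 ≤ v l) (i : Fin (N + N)) (j : Fin (N + q)) :
    (gateWeights G i j : EReal) * ((Fin.append u v j : ℝ) : EReal) ≠ ⊥ := by
  refine Fin.addCases (fun k => ?_) (fun k => ?_) i <;>
    refine Fin.addCases (fun k' => ?_) (fun l => ?_) j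
  · simp only [gateWeights, Fin.append_left, coe_realWeight, ← EReal.coe_mul]
    exact EReal.coe_ne_bot _
  · simp [gateWeights]
  · simp only [gateWeights, Fin.append_right, Fin.append_left]
    simp
  · simp only [gateWeights, Fin.append_right]
    split_ifs
    · rw [coe_topWeight, top_mul_coe_nonneg (hv l)]
      split_ifs <;> simp
    · simp

lemma relu_layer_gate (G : Fin N → Fin q → Prop) {u : Fin N → ℝ} {v : Fin q → ℝ}
    (hu : ∀ k, 0 ≤ u k) (hv : ∀ l, 0 ≤ v l) [∀ k, Decidable (∀ l, G k l → v l = 0)] :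
    relu (layer (gateWeights G) 0 (fun j => ((Fin.append u v j : ℝ) : EReal))) =
      Fin.append (fun k => (u k : EReal))
        (fun k => if ∀ l, G k l → v l = 0 then (0 : EReal) else ⊤) := by
  classical
  funext i
  refine Fin.addCases (fun k => ?_) (fun k => ?_) i
  · have h : ∀ k', (((if k = k' then 1 else 0 : ℝ)) : EReal) * (u k' : EReal) =
        if k = k' then (u k' : EReal) else 0 := by
      intro k'
      split_ifs <;> simp
    simp [relu, layer, gateWeights, Fin.sum_univ_add, h, hu k]
  · have hterm : ∀ l, ((if G k l then topWeight else realWeight 0 : ExtWeight) : EReal) *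
        (v l : EReal) = if G k l ∧ v l ≠ 0 then ⊤ else 0 := by
      intro l
      by_cases hG : G k l <;> by_cases h0 : v l = 0 <;> simp [hG, h0]
      exact EReal.top_mul_coe_of_pos (lt_of_le_of_ne (hv l) (Ne.symm h0))
    have hsum : relu (layer (gateWeights G) 0 (fun j => ((Fin.append u v j : ℝ) : EReal)))
        (Fin.natAdd N k) = max 0 (∑ l, if G k l ∧ v l ≠ 0 then (⊤ : EReal) else 0) := by
      simp only [relu, layer, gateWeights, Fin.sum_univ_add, Fin.append_left, Fin.append_right,
        hterm]
      simp
    rw [hsum, Fin.append_right]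
    split_ifs with h
    · rw [Finset.sum_eq_zero, max_self]
      intro l _
      rw [if_neg]
      rintro ⟨hG, hne⟩
      exact hne (h l hG)
    · push Not at h
      obtain ⟨l, hG, hne⟩ := h
      have hle : (⊤ : EReal) ≤ ∑ l, if G k l ∧ v l ≠ 0 then (⊤ : EReal) else 0 := by
        have := Finset.single_le_sum (f := fun l => if G k l ∧ v l ≠ 0 then (⊤ : EReal) else 0)
          (fun l _ => by split_ifs <;> simp) (Finset.mem_univ l)
        simpa only [if_pos (And.intro hG hne)] using this
      rw [top_le_iff.mp hle]
      simp

/-- An infinite gate has coefficient `-1` or `0`, and `0 * ∞ = 0`, so `+∞` cannot arise. -/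
lemma subWeights_mul_ne_top {u : Fin N → ℝ} {g : Fin N → EReal} (hg : ∀ k, g k = 0 ∨ g k = ⊤)
    (k : Fin N) (j : Fin (N + N)) :
    (subWeights N k j : EReal) * (Fin.append (fun k => (u k : EReal)) g j) ≠ ⊤ := by
  refine Fin.addCases (fun k' => ?_) (fun k' => ?_) j
  · simp only [subWeights, Fin.append_left, coe_realWeight, ← EReal.coe_mul]
    exact EReal.coe_ne_top _
  · simp only [subWeights, Fin.append_right, coe_realWeight]
    rcases hg k' with h | h <;> split_ifs <;> simp [h]

/-- A closed gate gives `u k - ∞ = -∞`, which ReLU sends to `0`; an open one leaves `u k ≥ 0`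
unchanged. -/
lemma relu_layer_sub {u : Fin N → ℝ} (hu : ∀ k, 0 ≤ u k) (Q : Fin N → Prop) [DecidablePred Q] :
    relu (layer (subWeights N) 0
        (Fin.append (fun k => (u k : EReal)) (fun k => if Q k then (0 : EReal) else ⊤))) =
      fun k => ((if Q k then u k else 0 : ℝ) : EReal) := by
  funext k
  have h : ∀ k', (((if k = k' then 1 else 0 : ℝ)) : EReal) * (u k' : EReal) =
      if k = k' then (u k' : EReal) else 0 := by
    intro k'
    split_ifs <;> simp
  have h' : ∀ k', (((if k = k' then -1 else 0 : ℝ)) : EReal) * (if Q k' then (0 : EReal) else ⊤) =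
      if k = k' then (if Q k' then (0 : EReal) else ⊥) else 0 := by
    intro k'
    split_ifs <;> simp
  simp only [relu, layer, subWeights, Fin.sum_univ_add, Fin.append_left, Fin.append_right,
    coe_realWeight, h, h', Finset.sum_ite_eq, Finset.mem_univ, if_true]
  split_ifs <;> simp [hu k]

lemma gated_computes (L : Fin N → (Fin n → ℝ) × ℝ) (H : Fin q → (Fin n → ℝ) × ℝ)
    (G : Fin N → Fin q → Prop) (w : Matrix (Fin m) (Fin N) ℝ) :
    (gated L H G w).Computes fun x i => ∑ k, w i k *
      {x | ∀ l, G k l → (H l).1 ⬝ᵥ x ≤ (H l).2}.indicator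
        (fun x => max 0 ((L k).1 ⬝ᵥ x - (L k).2)) x := by
  classical
  intro x
  have hu : ∀ k, 0 ≤ max 0 ((L k).1 ⬝ᵥ x - (L k).2) := fun k => le_max_left _ _
  have hv : ∀ l, 0 ≤ max 0 ((H l).1 ⬝ᵥ x - (H l).2) := fun l => le_max_left _ _
  constructor
  · refine ⟨layerDefined_real _ _, ?_, ?_, ?_⟩
    · rw [relu_layer_input]
      rintro i ⟨-, j, hj⟩
      exact gateWeights_mul_ne_bot G hv i j hj
    · rw [relu_layer_input, relu_layer_gate G hu hv]
      rintro i ⟨⟨j, hj⟩, -⟩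
      refine subWeights_mul_ne_top (fun k => ?_) i j hj
      split_ifs <;> simp
    · rw [relu_layer_input, relu_layer_gate G hu hv,
        relu_layer_sub hu (fun k => ∀ l, G k l → max 0 ((H l).1 ⬝ᵥ x - (H l).2) = 0)]
      exact layerDefined_real _ _
  · simp only [gated, eval]
    rw [relu_layer_input, relu_layer_gate G hu hv,
        relu_layer_sub hu (fun k => ∀ l, G k l → max 0 ((H l).1 ⬝ᵥ x - (H l).2) = 0), layer_real]
    simp [Set.indicator_apply]

end Gated

end ExtReLUNetwork

/-! ### The span of gated functions and gluing -/

section PiecewiseLinear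

variable {n : ℕ}

/-- A rectified affine function `x ↦ max 0 (a ⬝ x - c)`, restricted to a closed polyhedron and
extended by zero; `p.1` is `(a, c)` and `p.2` lists the half-spaces. -/
noncomputable def gatedRelu (p : ((Fin n → ℝ) × ℝ) × Finset ((Fin n → ℝ) × ℝ)) :
    (Fin n → ℝ) → ℝ :=
  {x | ∀ h ∈ p.2, h.1 ⬝ᵥ x ≤ h.2}.indicator fun x => max 0 (p.1.1 ⬝ᵥ x - p.1.2)

/-- The linear combinations of the functions `gatedRelu p`. -/
def gatedSpan (n : ℕ) : Submodule ℝ ((Fin n → ℝ) → ℝ) :=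
  Submodule.span ℝ (Set.range gatedRelu)

/-- Finitely many functions in `gatedSpan n` are computed by one network with three hidden
layers. -/
lemma exists_computes_of_mem_gatedSpan {m : ℕ} (g : Fin m → (Fin n → ℝ) → ℝ)
    (hg : ∀ i, g i ∈ gatedSpan n) :
    ∃ S : ExtReLUNetwork m 3 n, S.Computes fun x i => g i x := by
  classical
  have hg' := fun i => Finsupp.mem_span_range_iff_exists_finsupp.mp (hg i)
  choose c hc using hg'
  -- All coordinates share the atoms in `T` and the half-spaces in `U`; an atom absent from a
  -- coordinate gets coefficient `0`.
  let T := Finset.univ.biUnion fun i => (c i).support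
  let U := T.biUnion fun p => p.2
  let a : Fin T.card → ((Fin n → ℝ) × ℝ) × Finset ((Fin n → ℝ) × ℝ) := fun k => T.equivFin.symm k
  let H : Fin U.card → (Fin n → ℝ) × ℝ := fun l => U.equivFin.symm l
  refine ⟨ExtReLUNetwork.gated (fun k => (a k).1) H (fun k l => H l ∈ (a k).2)
    (fun i k => c i (a k)), ?_⟩
  convert ExtReLUNetwork.gated_computes (fun k => (a k).1) H (fun k l => H l ∈ (a k).2)
    (fun i k => c i (a k)) using 1
  funext x i
  have hatom : ∀ k, {x | ∀ l, H l ∈ (a k).2 → (H l).1 ⬝ᵥ x ≤ (H l).2}.indicator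
      (fun x => max 0 ((a k).1.1 ⬝ᵥ x - (a k).1.2)) x = gatedRelu (a k) x := by
    intro k
    rw [gatedRelu]
    congr 1
    ext y
    refine ⟨fun h z hz => ?_, fun h l => h _⟩
    have hzU : z ∈ U := Finset.mem_biUnion.mpr ⟨a k, (T.equivFin.symm k).2, hz⟩
    have := h (U.equivFin ⟨z, hzU⟩)
    simp only [H, Equiv.symm_apply_apply] at this
    exact this hz
  simp only [hatom]
  have hsupp : (c i).support ⊆ T := fun p hp => Finset.mem_biUnion.mpr ⟨i, Finset.mem_univ _, hp⟩
  rw [← hc i, Finsupp.sum_of_support_subset _ hsupp _ (fun _ _ => by simp),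
    Finset.sum_apply, ← Finset.sum_coe_sort,
    ← Equiv.sum_comp T.equivFin.symm]
  rfl

/-- Restricting to `P` (and extending by zero) preserves `gatedSpan n`. -/
def PreservesGatedSpan (P : Set (Fin n → ℝ)) : Prop :=
  ∀ φ ∈ gatedSpan n, P.indicator φ ∈ gatedSpan n

/-- On a generator, the restriction only adds `h` to its list of half-spaces; linearity does the
rest. -/
lemma preservesGatedSpan_halfSpace (h : (Fin n → ℝ) × ℝ) :
    PreservesGatedSpan {x | h.1 ⬝ᵥ x ≤ h.2} := by
  classical
  intro φ hφ
  induction hφ using Submodule.span_induction with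
  | mem φ hφ =>
    obtain ⟨p, rfl⟩ := hφ
    refine Submodule.subset_span ⟨(p.1, insert h p.2), ?_⟩
    simp only [gatedRelu, Set.indicator_indicator]
    congr 1
    ext x
    simp
  | zero => simp
  | add φ ψ _ _ hφ hψ => rw [Set.indicator_add']; exact add_mem hφ hψ
  | smul r φ _ hφ => 
    rw [show r • φ = fun x => r • φ x from rfl, Set.indicator_const_smul]
    exact Submodule.smul_mem _ r hφ

lemma PreservesGatedSpan.compl {P : Set (Fin n → ℝ)} (hP : PreservesGatedSpan P) :
    PreservesGatedSpan Pᶜ := by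
  intro φ hφ
  rw [Set.indicator_compl]
  exact sub_mem hφ (hP φ hφ)

lemma PreservesGatedSpan.inter {P Q : Set (Fin n → ℝ)} (hP : PreservesGatedSpan P)
    (hQ : PreservesGatedSpan Q) : PreservesGatedSpan (P ∩ Q) := by
  intro φ hφ
  rw [← Set.indicator_indicator]
  exact hP _ (hQ φ hφ)

lemma PreservesGatedSpan.biInter {ι : Type*} (s : Finset ι) (P : ι → Set (Fin n → ℝ))
    (hP : ∀ i, PreservesGatedSpan (P i)) : PreservesGatedSpan (⋂ i ∈ s, P i) := by
  classical
  induction s using Finset.induction_on with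
  | empty => intro φ hφ; simpa using hφ
  | insert a s _ ih => rw [Finset.set_biInter_insert]; exact (hP a).inter ih

lemma IsPolyhedron.preservesGatedSpan {P : Set (Fin n → ℝ)} (hP : IsPolyhedron P) :
    PreservesGatedSpan P := by
  obtain ⟨s, t, rfl⟩ := hP
  have hopen : ∀ h : (Fin n → ℝ) × ℝ, PreservesGatedSpan {x | h.1 ⬝ᵥ x < h.2} := by
    intro h
    -- An open half-space is the complement of the opposite closed one.
    have := (preservesGatedSpan_halfSpace (-h)).compl
    convert this using 1
    ext x
    simp
  convert (PreservesGatedSpan.biInter s _ preservesGatedSpan_halfSpace).inter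
    (PreservesGatedSpan.biInter t _ hopen) using 1
  ext x
  simp

/-- This is `t = max 0 t - max 0 (-t)`, with no half-spaces and hence no cut-off. -/
lemma affine_mem_gatedSpan (a : Fin n → ℝ) (c : ℝ) : (fun x => a ⬝ᵥ x + c) ∈ gatedSpan n := by
  have h : (fun x => a ⬝ᵥ x + c) = gatedRelu ((a, -c), ∅) - gatedRelu ((-a, c), ∅) := by
    funext x
    simp only [gatedRelu, Finset.notMem_empty, false_imp_iff, implies_true, Set.ofPred_true,
      Set.indicator_univ, Pi.sub_apply, neg_dotProduct, sub_neg_eq_add]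
    rcases le_total 0 (a ⬝ᵥ x + c) with h | h
    · rw [max_eq_right h, max_eq_left (by linarith), sub_zero]
    · rw [max_eq_left h, max_eq_right (by linarith)]; ring
  rw [h]
  exact sub_mem (Submodule.subset_span ⟨_, rfl⟩) (Submodule.subset_span ⟨_, rfl⟩)

/-- Functions in `gatedSpan n` given on finitely many pieces can be glued. -/
lemma exists_glue_mem_gatedSpan {p : ℕ} (P : Fin p → Set (Fin n → ℝ))
    (φ : Fin p → (Fin n → ℝ) → ℝ) (hP : ∀ j, PreservesGatedSpan (P j))
    (hφ : ∀ j, φ j ∈ gatedSpan n) :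
    ∃ g ∈ gatedSpan n, ∀ x ∈ ⋃ j, P j, ∃ j, x ∈ P j ∧ g x = φ j x := by
  induction p with
  | zero => exact ⟨0, zero_mem _, by simp⟩
  | succ p ih =>
    obtain ⟨g, hg, hgφ⟩ := ih (fun j => P j.succ) (fun j => φ j.succ) (fun j => hP _)
      (fun j => hφ _)
    -- On overlaps `P 0` takes priority, so the pieces need not be compatible.
    refine ⟨(P 0).indicator (φ 0) + (P 0)ᶜ.indicator g,
      add_mem (hP 0 _ (hφ 0)) ((hP 0).compl _ hg), fun x hx => ?_⟩
    by_cases h0 : x ∈ P 0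
    · exact ⟨0, h0, by simp [h0]⟩
    · obtain ⟨j, hj⟩ := Set.mem_iUnion.mp hx
      obtain ⟨i, rfl⟩ := Fin.exists_succ_eq.mpr (fun h : j = 0 => h0 (h ▸ hj))
      obtain ⟨k, hk, hgk⟩ := hgφ x (Set.mem_iUnion.mpr ⟨i, hj⟩)
      exact ⟨k.succ, hk, by simp [h0, hgk]⟩

end PiecewiseLinear

theorem mainTheorem3 (n m : ℕ) (K : Set (Fin n → ℝ)) (hK : IsCompact K)
    (f : (Fin n → ℝ) → (Fin m → ℝ)) (hf : ContinuousOn f K) (hpl : IsPiecewiseLinearOn f K) :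
    ∃ (S : ExtReLUNetwork m 3 n) (g : (Fin n → ℝ) → (Fin m → ℝ)),
      S.Computes g ∧ Set.EqOn g f K := by
  obtain ⟨p, P, α, β, hP, hcover, hfP⟩ := hpl
  have hglue := fun i => exists_glue_mem_gatedSpan P (fun j x => α j i ⬝ᵥ x + β j i)
    (fun j => (hP j).preservesGatedSpan) (fun j => affine_mem_gatedSpan _ _)
  choose g hg hgφ using hglue
  obtain ⟨S, hS⟩ := exists_computes_of_mem_gatedSpan g hg
  refine ⟨S, _, hS, fun x hx => funext fun i => ?_⟩
  -- The piece `j` may depend on the coordinate `i`; this is harmless, as `f` is given on `K` by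
  -- every piece containing `x`.
  obtain ⟨j, hj, hgj⟩ := hgφ i x (hcover hx)
  rw [hfP j x ⟨hx, hj⟩]
  exact hgj
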